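/- Theorem. Let $\Sigma$ be a finite alphabet. A structure over $\Sigma$ is a directed graph $\mathbb D$, finite or infinite, whose edges are labelled with letters of $\Sigma$. A language $Q\subseteq\Sigma^*$ defines the path query $Q(\mathbb D)=\{(x,y) : \text{there is a path in } \mathbb D \text{ from the vertex } x \text{ to the vertex } y \text{ labelled with some word } w\in Q\}$ (the empty word labels exactly the paths of length $0$ from a vertex to itself). A finite set $\mathcal Q$ of regular languages over $\Sigma$ determines a regular language $Q_0$ over $\Sigma$ if for every two structures $\mathbb D_1,\mathbb D_2$ over $\Sigma$ such that $Q(\mathbb D_1)=Q(\mathbb D_2)$ for every $Q\in\mathcal Q$, one has $Q_0(\mathbb D_1)=Q_0(\mathbb D_2)$; it finitely determines $Q_0$ if this holds for every two finite structures $\mathbb D_1,\mathbb D_2$. The Query Determinacy Problem for Regular Path Queries, in its unrestricted (respectively finite) version, is: given a finite alphabet $\Sigma$, a finite set $\mathcal Q$ of regular languages over $\Sigma$ and a regular language $Q_0$ over $\Sigma$ (all given by regular expressions), does $\mathcal Q$ determine (respectively finitely determine) $Q_0$? Both versions of this problem are undecidable. More precisely, both versions are co-r.e.-hard: every decision problem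 whose complement is recursively enumerable is many-one reducible, by a computable function, to the unrestricted version, and likewise to the finite version. -/

import Mathlib

universe u

namespace RPQ

/-- A structure (graph database) over the alphabet `α`: a directed graph with `α`-labelled edges.
Its vertices form a set `verts` of elements of an ambient type `U`, so that the answers to a query
in two structures with possibly different vertex sets can be compared. -/
structure LabeledGraph (α : Type) (U : Type u) where
  verts : Set U
  edge : α → U → U → Prop
  source_mem : ∀ {a x y}, edge a x y → x ∈ verts
  target_mem : ∀ {a x y}, edge a x y → y ∈ verts

namespace LabeledGraph

variable {α : Type} {U : Type u}

/-- The chain query `w(x, y)`: there is a path from `x` to `y` labelled with the word `w`. -/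
def Chain (D : LabeledGraph α U) : List α → U → U → Prop
  | [], x, y => x ∈ D.verts ∧ x = y
  | a :: w, x, y => ∃ z, D.edge a x z ∧ D.Chain w z y

/-- The set of answers to the path query given by a language `Q`: all pairs of vertices that are
connected by a path labelled with some word of `Q`. -/
def answer (D : LabeledGraph α U) (Q : Language α) : Set (U × U) :=
  {p | ∃ w ∈ Q, D.Chain w p.1 p.2}

end LabeledGraph

/-- `𝒬` determines `Q₀` (unrestricted version): structures may be infinite. -/
def Determines {α : Type} (𝒬 : Set (Language α)) (Q₀ : Language α) : Prop :=
  ∀ (U : Type u) (D₁ D₂ : LabeledGraph α U),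
    (∀ Q ∈ 𝒬, D₁.answer Q = D₂.answer Q) → D₁.answer Q₀ = D₂.answer Q₀

/-- `𝒬` determines `Q₀` (finite version): only finite structures are considered. -/
def FinitelyDetermines {α : Type} (𝒬 : Set (Language α)) (Q₀ : Language α) : Prop :=
  ∀ (U : Type u) (D₁ D₂ : LabeledGraph α U), D₁.verts.Finite → D₂.verts.Finite →
    (∀ Q ∈ 𝒬, D₁.answer Q = D₂.answer Q) → D₁.answer Q₀ = D₂.answer Q₀

/-- Gödel numbering of the regular expressions over the alphabet `Fin n`. -/
def encodeRegex (n : ℕ) : RegularExpression (Fin n) → ℕ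
  | .zero => 0
  | .epsilon => 1
  | .char a => a.val + 2
  | .plus P Q => 3 * Nat.pair (encodeRegex n P) (encodeRegex n Q) + (n + 2)
  | .comp P Q => 3 * Nat.pair (encodeRegex n P) (encodeRegex n Q) + 1 + (n + 2)
  | .star P => 3 * encodeRegex n P + 2 + (n + 2)

/-- The inverse of the Gödel numbering `encodeRegex`. -/
def decodeRegex (n : ℕ) (m : ℕ) : RegularExpression (Fin n) :=
  if h₀ : m = 0 then .zero
  else if _h₁ : m = 1 then .epsilon
  else if h : m - 2 < n then .char ⟨m - 2, h⟩
  else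
    let k := (m - (n + 2)) / 3
    have hk : k < m := by omega
    have _h₃ : k.unpair.1 < m := lt_of_le_of_lt k.unpair_left_le hk
    have _h₄ : k.unpair.2 < m := lt_of_le_of_lt k.unpair_right_le hk
    if (m - (n + 2)) % 3 = 0 then .plus (decodeRegex n k.unpair.1) (decodeRegex n k.unpair.2)
    else if (m - (n + 2)) % 3 = 1 then
      .comp (decodeRegex n k.unpair.1) (decodeRegex n k.unpair.2)
    else .star (decodeRegex n k)
termination_by m

theorem decodeRegex_encodeRegex (n : ℕ) (P : RegularExpression (Fin n)) :
    decodeRegex n (encodeRegex n P) = P := by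
  induction P with
  | zero => rw [encodeRegex, decodeRegex]; simp
  | epsilon => rw [encodeRegex, decodeRegex]; simp
  | char a => rw [encodeRegex, decodeRegex]; simp
  | plus P Q hP hQ =>
    rw [encodeRegex, decodeRegex]
    generalize hk : Nat.pair (encodeRegex n P) (encodeRegex n Q) = k
    have e : (3 * k + (n + 2) - (n + 2)) / 3 = k := by omega
    rw [dif_neg (by omega), dif_neg (by omega), dif_neg (by omega)]
    simp only [e]
    rw [if_pos (by omega), ← hk, Nat.unpair_pair, hP, hQ]
  | comp P Q hP hQ =>
    rw [encodeRegex, decodeRegex]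
    generalize hk : Nat.pair (encodeRegex n P) (encodeRegex n Q) = k
    have e : (3 * k + 1 + (n + 2) - (n + 2)) / 3 = k := by omega
    rw [dif_neg (by omega), dif_neg (by omega), dif_neg (by omega)]
    simp only [e]
    rw [if_neg (by omega), if_pos (by omega), ← hk, Nat.unpair_pair, hP, hQ]
  | star P hP =>
    rw [encodeRegex, decodeRegex]
    generalize hk : encodeRegex n P = k at hP ⊢
    have e : (3 * k + 2 + (n + 2) - (n + 2)) / 3 = k := by omega
    rw [dif_neg (by omega), dif_neg (by omega), dif_neg (by omega)]
    simp only [e]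
    rw [if_neg (by omega), if_neg (by omega), hP]

theorem encodeRegex_decodeRegex (n : ℕ) (m : ℕ) : encodeRegex n (decodeRegex n m) = m := by
  induction m using Nat.strong_induction_on with
  | _ m ih =>
    rw [decodeRegex]
    by_cases h0 : m = 0
    · rw [dif_pos h0, encodeRegex, h0]
    by_cases h1 : m = 1
    · rw [dif_neg h0, dif_pos h1, encodeRegex, h1]
    by_cases h2 : m - 2 < n
    · rw [dif_neg h0, dif_neg h1, dif_pos h2, encodeRegex]
      simp only
      omega
    rw [dif_neg h0, dif_neg h1, dif_neg h2]
    have hkm : (m - (n + 2)) / 3 < m := by omega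
    have i₁ := ih _ (lt_of_le_of_lt (Nat.unpair_left_le _) hkm)
    have i₂ := ih _ (lt_of_le_of_lt (Nat.unpair_right_le _) hkm)
    have i₃ := ih _ hkm
    dsimp only
    split_ifs <;> simp only [encodeRegex, i₁, i₂, i₃, Nat.pair_unpair] <;> omega

instance instDenumerableRegex (n : ℕ) : Denumerable (RegularExpression (Fin n)) :=
  Denumerable.mk'
    ⟨encodeRegex n, decodeRegex n, decodeRegex_encodeRegex n, encodeRegex_decodeRegex n⟩

/-- An instance of the query determinacy problem for regular path queries: the size `n` of a finite
alphabet, a finite list `𝒬` of regular expressions over that alphabet, and another regular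
expression `Q₀` over it. It inherits from `instDenumerableRegex` the coding by natural numbers
under which computability is understood. -/
abbrev QDPInstance : Type :=
  Σ n : ℕ, List (RegularExpression (Fin n)) × RegularExpression (Fin n)

/-- The finite set of regular languages `𝒬` of an instance. -/
def QDPInstance.views (I : QDPInstance) : Set (Language (Fin I.1)) :=
  {L | ∃ P ∈ I.2.1, P.matches' = L}

/-- The regular language `Q₀` of an instance. -/
def QDPInstance.query (I : QDPInstance) : Language (Fin I.1) :=
  I.2.2.matches'

/-- The query determinacy problem for regular path queries, unrestricted version. -/
def QDP (I : QDPInstance) : Prop :=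
  Determines.{u} I.views I.query

/-- The query determinacy problem for regular path queries, finite version. -/
def FiniteQDP (I : QDPInstance) : Prop :=
  FinitelyDetermines.{u} I.views I.query

/-- A decision problem is co-r.e.-hard if every problem with a recursively enumerable complement
is many-one reducible to it. -/
def CoREHard {β : Type} [Primcodable β] (q : β → Prop) : Prop :=
  ∀ (γ : Type) [Primcodable γ] (p : γ → Prop), REPred (fun c => ¬ p c) → p ≤₀ q

end RPQ

namespace RPQ

open Relation

/-! ### Paths and answers -/

namespace LabeledGraph

variable {α : Type} {U : Type u} {D D₁ D₂ : LabeledGraph α U}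

/-! A recursively enumerable predicate `p` is turned into instances that are determined when `p m`
fails and not even finitely determined when `p m` holds. Since determinacy implies finite
determinacy, one reduction serves both versions.

Configurations of a deterministic rewriting system are spelled by paths whose head letter carries
the parity of the step number. The views show the tape and start letters, hide the colour of the
closing letter, and show a window only up to one rewriting step. The query asks for an initial
configuration closed with colour `false`, or for a bad word: a clash of colours, or a rejecting
window. Bad words also form a view. Suppose two structures agree on the views, but an initial path
of the first joins a pair that the query misses in the second. Then the second must close with the
other colour, and each step view hands the configuration to the other structure, advanced by one
step, because an unadvanced copy would clash. The run alternates between the structures until a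
rejecting configuration produces a bad answer, a contradiction (`answer_subset_of_reject`).

Conversely, a halting run that never rejects splits by parity into two finite structures that agree
on all views and differ on the query (`not_finitelyDetermines_of_accept`). The record of the last
step in the head letter tells which window was rewritten, so windows can be matched backwards as
well as forwards.

The rewriting system simulates a Turing machine that halts on every input used and decides `F (2 ^
k) (2 ^ m)`, where `p m` means that some `k` makes this true. A star in the query lets `k` vary,
while `m` enters as a power. Powers of two have binary expansions of exactly this shape
(`exists_machine_of_computable`, `exists_startLang_regex`). -/

theorem Chain.source_mem : ∀ {w : List α} {x y : U}, D.Chain w x y → x ∈ D.verts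
  | [], _, _, h => h.1
  | _ :: _, _, _, ⟨_, h, _⟩ => D.source_mem h

theorem Chain.target_mem : ∀ {w : List α} {x y : U}, D.Chain w x y → y ∈ D.verts
  | [], _, _, h => h.2 ▸ h.1
  | _ :: _, _, _, ⟨_, _, h⟩ => Chain.target_mem h

theorem chain_append {v w : List α} {x z : U} :
    D.Chain (v ++ w) x z ↔ ∃ y, D.Chain v x y ∧ D.Chain w y z := by
  induction v generalizing x with
  | nil =>
    refine ⟨fun h => ⟨x, ⟨Chain.source_mem h, rfl⟩, h⟩, ?_⟩
    rintro ⟨y, ⟨-, rfl⟩, h⟩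
    exact h
  | cons a v ih =>
    constructor
    · rintro ⟨y, hy, h⟩
      obtain ⟨y', h₁, h₂⟩ := ih.1 h
      exact ⟨y', ⟨y, hy, h₁⟩, h₂⟩
    · rintro ⟨y', ⟨y, hy, h₁⟩, h₂⟩
      exact ⟨y, hy, ih.2 ⟨y', h₁, h₂⟩⟩

theorem chain_singleton {a : α} {x y : U} : D.Chain [a] x y ↔ D.edge a x y := by
  constructor
  · rintro ⟨z, h, -, rfl⟩
    exact h
  · exact fun h => ⟨y, h, D.target_mem h, rfl⟩

theorem Chain.exists_edge {w : List α} {x y : U} (h : D.Chain w x y) {a : α} (ha : a ∈ w) :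
    ∃ x' y', D.edge a x' y' := by
  obtain ⟨u, v, rfl⟩ := List.append_of_mem ha
  obtain ⟨x', -, y', h', -⟩ := chain_append.1 h
  exact ⟨x', y', h'⟩

theorem answer_add (P Q : Language α) : D.answer (P + Q) = D.answer P ∪ D.answer Q := by
  ext p
  simp only [answer, Language.mem_add, Set.mem_ofPred_eq, Set.mem_union, or_and_right, exists_or]

theorem mem_answer_singleton {a : α} {x y : U} :
    (x, y) ∈ D.answer {[a]} ↔ D.edge a x y := by
  rw [← chain_singleton]
  constructor
  · rintro ⟨w, rfl, h⟩
    exact h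
  · exact fun h => ⟨_, rfl, h⟩

theorem edge_iff_of_answer_eq {a : α} (h : D₁.answer {[a]} = D₂.answer {[a]}) {x y : U} :
    D₁.edge a x y ↔ D₂.edge a x y := by
  rw [← mem_answer_singleton, h, mem_answer_singleton]

end LabeledGraph

/-! ### Rewriting systems and the views that encode them -/

/-- The letters of the configurations of a rewriting system with tape symbols `T` and states `K`.
The head letter carries the parity of the number of steps made so far and, except initially, the
window to which the last step was applied. -/
inductive Letter (T K : Type) : Type
  | start
  | close (c : Bool)
  | tape (t : T)
  | head (c : Bool) (i : Option (T × K × T)) (q : K)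

/-- The transition function of a rewriting system with a head: a window `x q y` is replaced by
`pre p post`. -/
abbrev Rules (T K : Type) : Type := T → K → T → Option (List T × K × List T)

/-- A configuration of a rewriting system, with the head between the words `left` and `right`. -/
@[ext]
structure Config (T K : Type) where
  left : List T
  parity : Bool
  last : Option (T × K × T)
  state : K
  right : List T

open Letter

variable {T K : Type}

/-- One step of a rewriting system. -/
inductive Rules.Step (δ : Rules T K) : Config T K → Config T K → Prop
  | mk {x q y pre p post} (L R : List T) (c : Bool) (i : Option (T × K × T)) :
    δ x q y = some (pre, p, post) →
      Step δ ⟨L ++ [x], c, i, q, y :: R⟩ ⟨L ++ pre, !c, some (x, q, y), p, post ++ R⟩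

/-- Finitely many steps of a rewriting system. -/
abbrev Rules.Reaches (δ : Rules T K) : Config T K → Config T K → Prop := ReflTransGen δ.Step

/-- The head of the configuration is in a window satisfying `rej`. -/
def Config.InWindow (C : Config T K) (rej : T → K → T → Prop) : Prop :=
  ∃ L x y R, C.left = L ++ [x] ∧ C.right = y :: R ∧ rej x C.state y

theorem Rules.Step.unique {δ : Rules T K} {C C₁ C₂ : Config T K} (h₁ : δ.Step C C₁)
    (h₂ : δ.Step C C₂) : C₁ = C₂ := by
  obtain ⟨L, R, c, i, h₁⟩ := h₁
  generalize hC : Config.mk _ _ _ _ _ = C at h₂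
  obtain ⟨L', R', c', i', h₂⟩ := h₂
  simp only [Config.mk.injEq, List.cons.injEq] at hC
  obtain ⟨hL, rfl, rfl, rfl, rfl, rfl⟩ := hC
  obtain ⟨rfl, hx⟩ := List.append_inj' hL rfl
  cases hx
  rw [h₁] at h₂
  cases h₂
  rfl

theorem Rules.Step.parity_eq {δ : Rules T K} {C C' : Config T K} (h : δ.Step C C') :
    C'.parity = !C.parity := by
  cases h
  rfl

/-- Determinism makes the reachable set a single orbit, and the terminal element `b` cuts it off
after finitely many steps. -/
theorem finite_reaches {σ : Type*} {r : σ → σ → Prop} (hr : ∀ a b c, r a b → r a c → b = c)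
    {a b : σ} (h : ReflTransGen r a b) (hb : ∀ c, ¬ r b c) : {c | ReflTransGen r a c}.Finite := by
  induction h using ReflTransGen.head_induction_on with
  | refl =>
    refine (Set.finite_singleton b).subset fun c hc => ?_
    rcases hc.cases_head with rfl | ⟨d, hd, -⟩
    · rfl
    · exact absurd hd (hb d)
  | @head a a' haa' _ ih =>
    refine (ih.insert a).subset fun c hc => ?_
    rcases hc.cases_head with rfl | ⟨d, hd, hdc⟩
    · exact Or.inl rfl
    · exact Or.inr (hr _ _ _ hd haa' ▸ hdc)

/-- The two forms of a rewritten window. -/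
def stepLang (δ : Rules T K) (c : Bool) (x : T) (q : K) (y : T) : Language (Letter T K) :=
  {w | ∃ pre p post, δ x q y = some (pre, p, post) ∧
    ((∃ i, w = [tape x, head c i q, tape y]) ∨
      w = pre.map tape ++ head (!c) (some (x, q, y)) p :: post.map tape)}

/-- The words in which the head letter and the closing letter have different colours. -/
def clashLang (T K : Type) : Language (Letter T K) :=
  {w | ∃ u v c i q, w = start :: (u ++ head c i q :: (v ++ [close (!c)]))}

/-- The words in which the head is in a rejecting window. -/
def rejectLang (rej : T → K → T → Prop) : Language (Letter T K) :=
  {w | ∃ u v c i c' x q y, rej x q y ∧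
    w = start :: (u ++ tape x :: head c i q :: tape y :: (v ++ [close c']))}

/-- The words that must not occur between the end points of a configuration. -/
def badLang (rej : T → K → T → Prop) : Language (Letter T K) :=
  clashLang T K + rejectLang rej

/-- The words that spell the initial configurations with left and right part in `S`. -/
def startLang (q₀ : K) (S : Set (List T × List T)) : Language (Letter T K) :=
  {w | ∃ L R i, (L, R) ∈ S ∧
    w = start :: (L.map tape ++ head false i q₀ :: (R.map tape ++ [close false]))}

/-- The views that simulate a rewriting system. -/
def ruleViews (δ : Rules T K) (rej : T → K → T → Prop) : Set (Language (Letter T K)) :=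
  {Q | (∃ t, Q = {[tape t]}) ∨ Q = {[start]} ∨ Q = {[close false]} + {[close true]} ∨
    (∃ c x q y, Q = stepLang δ c x q y) ∨ Q = badLang rej}

/-! ### Rejecting runs force determinacy -/

section Soundness

variable {U : Type u}

/-- The graph has a path that spells the configuration `C`, with the given end points. -/
def Spells (D : LabeledGraph (Letter T K) U) (C : Config T K) (a b : U) : Prop :=
  D.Chain (C.left.map tape ++ head C.parity C.last C.state :: C.right.map tape) a b

/-- The condition on `x` matters only for the empty word, whose path requires `x` to be a vertex. -/
theorem chain_tape_iff {D₁ D₂ : LabeledGraph (Letter T K) U}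
    (h : ∀ t x y, D₁.edge (tape t) x y ↔ D₂.edge (tape t) x y) {w : List T} {x y : U}
    (hx : x ∈ D₁.verts ↔ x ∈ D₂.verts) :
    D₁.Chain (w.map tape) x y ↔ D₂.Chain (w.map tape) x y := by
  induction w generalizing x with
  | nil => simp [LabeledGraph.Chain, hx]
  | cons t w ih =>
    constructor
    · rintro ⟨z, hz, h'⟩
      have hz' := (h t x z).1 hz
      exact ⟨z, hz', (ih ⟨fun _ => D₂.target_mem hz', fun _ => D₁.target_mem hz⟩).1 h'⟩
    · rintro ⟨z, hz, h'⟩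
      have hz' := (h t x z).2 hz
      exact ⟨z, hz', (ih ⟨fun _ => D₂.target_mem hz, fun _ => D₁.target_mem hz'⟩).2 h'⟩

/-- If one graph spells a configuration, the other one spells the next configuration or the same
configuration, up to the record of the last step. -/
theorem Spells.step {δ : Rules T K} {D₁ D₂ : LabeledGraph (Letter T K) U}
    (htape : ∀ t x y, D₁.edge (tape t) x y ↔ D₂.edge (tape t) x y)
    (hstep : ∀ c x q y, D₁.answer (stepLang δ c x q y) = D₂.answer (stepLang δ c x q y))
    {C C' : Config T K} {a b : U} (ha : a ∈ D₁.verts ↔ a ∈ D₂.verts) (h : Spells D₁ C a b)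
    (hC : δ.Step C C') : Spells D₂ C' a b ∨ ∃ i, Spells D₂ {C with last := i} a b := by
  obtain ⟨L, R, c, i, hδ⟩ := hC
  rename_i x q y pre p post
  have h : D₁.Chain (L.map tape ++ ([tape x, head c i q, tape y] ++ R.map tape)) a b := by
    simpa [Spells] using h
  obtain ⟨s, hL, h⟩ := LabeledGraph.chain_append.1 h
  obtain ⟨t, hw, hR⟩ := LabeledGraph.chain_append.1 h
  have hst : (s, t) ∈ D₂.answer (stepLang δ c x q y) :=
    hstep c x q y ▸ ⟨_, ⟨pre, p, post, hδ, Or.inl ⟨i, rfl⟩⟩, hw⟩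
  obtain ⟨w, hmem, hw₂⟩ := hst
  have hL₂ := (chain_tape_iff htape ha).1 hL
  have hR₂ := (chain_tape_iff htape (x := t)
    ⟨fun _ => hw₂.target_mem, fun _ => hw.target_mem⟩).1 hR
  have hall : D₂.Chain (L.map tape ++ (w ++ R.map tape)) a b :=
    LabeledGraph.chain_append.2 ⟨s, hL₂, LabeledGraph.chain_append.2 ⟨t, hw₂, hR₂⟩⟩
  obtain ⟨pre', p', post', hδ', ⟨i', rfl⟩ | rfl⟩ := hmem
  · exact Or.inr ⟨i', by simpa [Spells] using hall⟩
  · rw [hδ] at hδ'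
    cases hδ'
    exact Or.inl (by simpa [Spells] using hall)

/-- If a pair were lost in `D₂`, the two graphs would have to close the path with different colours.
The step views would then drive the run back and forth between them up to a rejecting window, making
the pair a bad answer. The hypothesis covers every initial record `i`, since `startLang` leaves that
record free. -/
theorem answer_subset_of_reject {δ : Rules T K} {rej : T → K → T → Prop} {q₀ : K}
    {S : Set (List T × List T)}
    (hS : ∀ L R i, (L, R) ∈ S → ∃ C, δ.Reaches ⟨L, false, i, q₀, R⟩ C ∧ C.InWindow rej)
    (D₁ D₂ : LabeledGraph (Letter T K) U)
    (h : ∀ Q ∈ ruleViews δ rej, D₁.answer Q = D₂.answer Q) :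
    D₁.answer (startLang q₀ S + badLang rej) ⊆ D₂.answer (startLang q₀ S + badLang rej) := by
  have htape : ∀ t x y, D₁.edge (tape t) x y ↔ D₂.edge (tape t) x y := fun t x y =>
    LabeledGraph.edge_iff_of_answer_eq (h _ (Or.inl ⟨t, rfl⟩))
  have hstart : ∀ x y, D₁.edge start x y ↔ D₂.edge start x y := fun x y =>
    LabeledGraph.edge_iff_of_answer_eq (h _ (Or.inr (Or.inl rfl)))
  have hclose := h _ (Or.inr (Or.inr (Or.inl rfl)))
  have hstep : ∀ c x q y, D₁.answer (stepLang δ c x q y) = D₂.answer (stepLang δ c x q y) :=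
    fun c x q y => h _ (Or.inr (Or.inr (Or.inr (Or.inl ⟨c, x, q, y, rfl⟩))))
  have hbad := h _ (Or.inr (Or.inr (Or.inr (Or.inr rfl))))
  rintro ⟨a, b⟩ hab
  by_contra hnot
  rw [LabeledGraph.answer_add, Set.mem_union, not_or] at hnot
  obtain ⟨hnS, hnB⟩ := hnot
  rw [LabeledGraph.answer_add, Set.mem_union, hbad, or_iff_left hnB] at hab
  obtain ⟨_, ⟨L, R, i, hLR, rfl⟩, a', haa', hab⟩ := hab
  rw [← List.cons_append, ← List.append_assoc] at hab
  obtain ⟨b', hsp, hbb'⟩ := LabeledGraph.chain_append.1 hab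
  rw [LabeledGraph.chain_singleton] at hbb'
  set C₀ : Config T K := ⟨L, false, i, q₀, R⟩
  replace hsp : Spells D₁ C₀ a' b' := hsp
  have haa'₂ := (hstart _ _).1 haa'
  have hv₁ : a' ∈ D₁.verts := D₁.target_mem haa'
  have hv₂ : a' ∈ D₂.verts := D₂.target_mem haa'₂
  obtain ⟨C, hreach, hC⟩ := hS L R i hLR
  have clash : ∀ {D : LabeledGraph (Letter T K) U} {C : Config T K}, D.edge start a a' →
      Spells D C a' b' → D.edge (close (!C.parity)) b' b → (a, b) ∈ D.answer (badLang rej) := by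
    intro D C h₁ h₂ h₃
    refine ⟨_, Or.inl ⟨C.left.map tape, C.right.map tape, C.parity, C.last, C.state, rfl⟩,
      a', h₁, ?_⟩
    rw [← List.cons_append, ← List.append_assoc]
    exact LabeledGraph.chain_append.2 ⟨b', h₂, LabeledGraph.chain_singleton.2 h₃⟩
  have reject : ∀ {D : LabeledGraph (Letter T K) U} {C : Config T K} {c : Bool},
      D.edge start a a' → Spells D C a' b' → D.edge (close c) b' b → C.InWindow rej →
        (a, b) ∈ D.answer (badLang rej) := by
    rintro D ⟨_, c', i', q, _⟩ c h₁ h₂ h₃ ⟨L', x, y, R', rfl, rfl, hrej⟩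
    refine ⟨_, Or.inr ⟨L'.map tape, R'.map tape, c', i', c, x, q, y, hrej, rfl⟩, a', h₁, ?_⟩
    have := LabeledGraph.chain_append.2 ⟨b', h₂, LabeledGraph.chain_singleton.2 h₃⟩
    simpa using this
  rcases hreach.cases_head with rfl | ⟨C₁, hC₁, -⟩
  · exact hnB (hbad ▸ reject haa' hsp hbb' hC)
  -- If `D₂` closed with `false`, the next configuration would clash with it. The unadvanced one
  -- would again be an initial word, because its record is arbitrary.
  have hred : D₂.edge (close true) b' b := by
    have hmem : (b', b) ∈ D₂.answer ({[close false]} + {[close true]}) := by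
      rw [← hclose, LabeledGraph.answer_add]
      exact Or.inl (LabeledGraph.mem_answer_singleton.2 hbb')
    rw [LabeledGraph.answer_add] at hmem
    rcases hmem with hmem | hmem
    · rw [LabeledGraph.mem_answer_singleton] at hmem
      exfalso
      rcases hsp.step htape hstep (by simp [hv₁, hv₂]) hC₁ with h' | ⟨i', h'⟩
      · exact hnB (clash haa'₂ h' (by simpa [hC₁.parity_eq] using hmem))
      · refine hnS ⟨_, ⟨L, R, i', hLR, rfl⟩, a', haa'₂, ?_⟩
        rw [← List.cons_append, ← List.append_assoc]
        exact LabeledGraph.chain_append.2 ⟨b', h', LabeledGraph.chain_singleton.2 hmem⟩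
    · exact LabeledGraph.mem_answer_singleton.1 hmem
  -- The graphs are indexed by the colour of their closing edge, so a configuration of parity `c`
  -- belongs in `D c`.
  let D : Bool → LabeledGraph (Letter T K) U := fun c => cond c D₂ D₁
  have hDstart : ∀ c, (D c).edge start a a' := by rintro (_ | _) <;> assumption
  have hDclose : ∀ c, (D c).edge (close c) b' b := by rintro (_ | _) <;> assumption
  have hDbad : ∀ c, (a, b) ∉ (D c).answer (badLang rej) := by
    rintro (_ | _)
    · exact fun h' => hnB (hbad ▸ h')
    · exact hnB
  have hDstep : ∀ {C C'} (c), Spells (D c) C a' b' → δ.Step C C' → Spells (D (!c)) C' a' b' ∨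
      ∃ i, Spells (D (!c)) {C with last := i} a' b' := by
    rintro C C' (_ | _) h₁ h₂
    · exact h₁.step htape hstep (by simp [hv₁, hv₂]) h₂
    · exact h₁.step (fun t x y => (htape t x y).symm) (fun c x q y => (hstep c x q y).symm)
        (by simp [hv₁, hv₂]) h₂
  have hall : Spells (D C.parity) C a' b' := by
    clear hC
    induction hreach with
    | refl => exact hsp
    | @tail C C' _ hCC' ih =>
      rcases hDstep C.parity ih hCC' with h' | ⟨i', h'⟩
      · rwa [hCC'.parity_eq]
      -- An unadvanced configuration has landed in the graph of the opposite colour.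
      · exact absurd (clash (hDstart _) h' (hDclose _)) (hDbad _)
  exact hDbad _ (reject (hDstart _) hall (hDclose _) hC)

/-- If all initial configurations lead to a rejecting one, then the views determine the query. -/
theorem determines_of_reject {δ : Rules T K} {rej : T → K → T → Prop} {q₀ : K}
    {S : Set (List T × List T)}
    (hS : ∀ L R i, (L, R) ∈ S → ∃ C, δ.Reaches ⟨L, false, i, q₀, R⟩ C ∧ C.InWindow rej) :
    Determines.{u} (ruleViews δ rej) (startLang q₀ S + badLang rej) := fun _ D₁ D₂ h =>
  (answer_subset_of_reject hS D₁ D₂ h).antisymm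
    (answer_subset_of_reject hS D₂ D₁ fun Q hQ => (h Q hQ).symm)

end Soundness


/-! ### The finite counterexample for an accepting run -/

open Relation Letter

/-- The vertices of the counterexample: the words that can stand to the left or to the right of
the head, and the two end points of the configurations. -/
inductive Vertex (T : Type) : Type u
  | source
  | sink
  | left (l : List T)
  | right (l : List T)

namespace Vertex

def length : Vertex.{u} T → ℕ
  | source => 0
  | sink => 0
  | left l => l.length
  | right l => l.length

theorem finite_length_le [Finite T] (N : ℕ) : {v : Vertex.{u} T | v.length ≤ N}.Finite := by
  have hl := List.finite_length_le T N
  refine ((((hl.image right).union (hl.image left)).insert sink).insert source).subset ?_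
  rintro (_ | _ | l | l) h
  · exact Or.inl rfl
  · exact Or.inr (Or.inl rfl)
  · exact Or.inr (Or.inr (Or.inr ⟨l, h, rfl⟩))
  · exact Or.inr (Or.inr (Or.inl ⟨l, h, rfl⟩))

end Vertex

open Vertex

/-- The edges of colour `c` of the counterexample that spells the configurations in `A`. -/
inductive RunEdge (A : Set (Config T K)) (N : ℕ) (c : Bool) :
    Letter T K → Vertex.{u} T → Vertex.{u} T → Prop
  | start : RunEdge A N c start source (left [])
  | close : RunEdge A N c (close c) (right []) sink
  | left (l : List T) (t : T) :
    l.length < N → RunEdge A N c (tape t) (left l) (left (l ++ [t]))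
  | right (t : T) (l : List T) :
    l.length < N → RunEdge A N c (tape t) (right (t :: l)) (right l)
  | head (L i q R) : ⟨L, c, i, q, R⟩ ∈ A → L.length ≤ N → R.length ≤ N →
    RunEdge A N c (head c i q) (left L) (right R)

/-- The part of colour `c` of the counterexample that spells the configurations in `A`. -/
def runGraph (A : Set (Config T K)) (N : ℕ) (c : Bool) :
    LabeledGraph (Letter T K) (Vertex.{u} T) where
  verts := {v | v.length ≤ N}
  edge := RunEdge A N c
  source_mem h := by
    cases h <;> simp only [Set.mem_ofPred_eq, Vertex.length, List.length_cons, List.length_nil] <;>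
      omega
  target_mem h := by
    cases h <;>
      simp only [Set.mem_ofPred_eq, Vertex.length, List.length_append, List.length_cons,
        List.length_nil] <;> omega

section RunGraph

variable {A : Set (Config T K)} {N : ℕ} {c : Bool}

theorem runGraph_chain_right {w : List T} {R : List T} {v : Vertex.{u} T} :
    (runGraph A N c).Chain (w.map tape) (right R) v ↔
      ∃ R', R = w ++ R' ∧ v = right R' ∧ R.length ≤ N := by
  induction w generalizing R with
  | nil =>
    constructor
    · rintro ⟨h, rfl⟩
      exact ⟨R, rfl, rfl, h⟩
    · rintro ⟨_, rfl, rfl, h⟩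
      exact ⟨h, rfl⟩
  | cons t w ih =>
    constructor
    · rintro ⟨z, hz, h⟩
      cases hz with
      | right _ l hl =>
        obtain ⟨R', rfl, rfl, h⟩ := ih.1 h
        exact ⟨R', rfl, rfl, hl⟩
    · rintro ⟨R', rfl, rfl, h⟩
      have h' : (w ++ R').length < N := h
      exact ⟨right (w ++ R'), .right _ _ h', ih.2 ⟨R', rfl, rfl, h'.le⟩⟩

theorem runGraph_chain_left {w : List T} {L : List T} {v : Vertex.{u} T} :
    (runGraph A N c).Chain (w.map tape) (left L) v ↔
      v = left (L ++ w) ∧ (L ++ w).length ≤ N := by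
  induction w generalizing L with
  | nil =>
    constructor
    · rintro ⟨h, rfl⟩
      exact ⟨by simp, by rwa [List.append_nil]⟩
    · rintro ⟨rfl, h⟩
      rw [List.append_nil] at h ⊢
      exact ⟨h, rfl⟩
  | cons t w ih =>
    constructor
    · rintro ⟨z, hz, h⟩
      cases hz with
      | left l _ hl =>
        have h' := ih.1 h
        rwa [List.append_assoc, List.singleton_append] at h'
    · rintro ⟨rfl, h⟩
      refine ⟨left (L ++ [t]), .left _ _ ?_, ih.2 ⟨by simp, by simpa using h⟩⟩
      simp only [List.length_append, List.length_cons] at h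
      omega

/-- The paths of the counterexample that pass a head letter. -/
theorem runGraph_chain_head {pre post : List T} {c' : Bool} {i : Option (T × K × T)} {q : K}
    {s t : Vertex.{u} T} :
    (runGraph A N c).Chain (pre.map tape ++ head c' i q :: post.map tape) s t ↔
      c' = c ∧ ∃ L R, s = left L ∧ t = right R ∧ ⟨L ++ pre, c, i, q, post ++ R⟩ ∈ A ∧
        (L ++ pre).length ≤ N ∧ (post ++ R).length ≤ N := by
  rw [LabeledGraph.chain_append]
  constructor
  · rintro ⟨s', hs, t', ht', ht⟩
    generalize hh : head c' i q = a at ht'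
    cases ht' with
    | start => cases hh
    | close => cases hh
    | left => cases hh
    | right => cases hh
    | head L i' q' R hA hL hR =>
      cases hh
      obtain ⟨R', rfl, rfl, -⟩ := runGraph_chain_right.1 ht
      refine ⟨rfl, ?_⟩
      cases s with
      | left L' =>
        obtain ⟨h, -⟩ := runGraph_chain_left.1 hs
        cases h
        exact ⟨L', R', rfl, rfl, hA, hL, hR⟩
      | right L' =>
        obtain ⟨R', -, h, -⟩ := runGraph_chain_right.1 hs
        cases h
      | source =>
        cases pre with
        | nil => cases hs.2
        | cons t pre =>
          obtain ⟨z, hz, -⟩ := hs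
          cases hz
      | sink =>
        cases pre with
        | nil => cases hs.2
        | cons t pre =>
          obtain ⟨z, hz, -⟩ := hs
          cases hz
  · rintro ⟨rfl, L, R, rfl, rfl, hA, hL, hR⟩
    exact ⟨left (L ++ pre), runGraph_chain_left.2 ⟨rfl, hL⟩, right (post ++ R),
      .head _ _ _ _ hA hL hR, runGraph_chain_right.2 ⟨R, rfl, rfl, hR⟩⟩

/-- All head and closing edges have the single colour `c`, so no clash is possible. A rejecting
window would have to lie in a member of `A`. -/
theorem runGraph_answer_badLang {rej : T → K → T → Prop} (hA : ∀ C ∈ A, ¬ C.InWindow rej) :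
    (runGraph.{u} A N c).answer (badLang rej) = ∅ := by
  refine Set.eq_empty_iff_forall_notMem.2 ?_
  rintro ⟨a, b⟩ ⟨w, ⟨u, v, c', i, q, rfl⟩ | ⟨u, v, c', i, c'', x, q, y, hrej, rfl⟩, h⟩
  · obtain ⟨_, _, h₁⟩ := h.exists_edge (a := head c' i q) (by simp)
    obtain ⟨_, _, h₂⟩ := h.exists_edge (a := close (!c')) (by simp)
    cases h₁
    generalize hd : (!c) = d at h₂
    cases h₂
    simp at hd
  · obtain ⟨z, -, h⟩ := h
    obtain ⟨s, -, h⟩ := LabeledGraph.chain_append.1 h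
    have h' : (runGraph A N c).Chain
        (([x].map tape ++ head c' i q :: [y].map tape) ++ (v ++ [close c''])) s b := h
    obtain ⟨t, h, -⟩ := LabeledGraph.chain_append.1 h'
    obtain ⟨rfl, L, R, -, -, hC, -⟩ := runGraph_chain_head.1 h
    exact hA _ hC ⟨L, x, y, R, rfl, rfl, hrej⟩

end RunGraph

/-- The two parts of a run spell the same rewritten windows. -/
theorem runGraph_answer_stepLang_subset {δ : Rules T K} {C₀ : Config T K} (h₀ : C₀.last = none)
    {N : ℕ} (hN : ∀ C, δ.Reaches C₀ C → C.left.length ≤ N ∧ C.right.length ≤ N)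
    (c d : Bool) (x : T) (q : K) (y : T) :
    (runGraph.{u} {C | δ.Reaches C₀ C} N d).answer (stepLang δ c x q y) ⊆
      (runGraph {C | δ.Reaches C₀ C} N (!d)).answer (stepLang δ c x q y) := by
  rintro ⟨s, t⟩ ⟨w, ⟨pre, p, post, hδ, ⟨i, rfl⟩ | rfl⟩, h⟩
  · have h : (runGraph {C | δ.Reaches C₀ C} N d).Chain
      ([x].map tape ++ head c i q :: [y].map tape) s t := h
    obtain ⟨rfl, L, R, rfl, rfl, hC, -⟩ := runGraph_chain_head.1 h
    have hC' := ReflTransGen.tail hC (Rules.Step.mk L R c i hδ)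
    exact ⟨_, ⟨pre, p, post, hδ, Or.inr rfl⟩,
      runGraph_chain_head.2 ⟨rfl, L, R, rfl, rfl, hC', hN _ hC'⟩⟩
  · obtain ⟨rfl, L, R, rfl, rfl, hC, -⟩ := runGraph_chain_head.1 h
    -- The rewritten window carries a record, unlike the initial configuration, so a previous step
    -- exists. The record identifies the window that step replaced, and cancelling the known words
    -- recovers the context.
    rcases ReflTransGen.cases_tail hC with h | ⟨B, hB, hBC⟩
    · rw [← h] at h₀
      cases h₀
    · generalize hC' : Config.mk _ _ _ _ _ = C' at hBC
      obtain ⟨L', R', c', i', hδ'⟩ := hBC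
      simp only [Config.mk.injEq, Option.some.injEq, Prod.mk.injEq, Bool.not_inj_iff] at hC'
      obtain ⟨hL, rfl, ⟨rfl, rfl, rfl⟩, rfl, hR⟩ := hC'
      rw [hδ] at hδ'
      cases hδ'
      obtain rfl := List.append_cancel_right hL
      obtain rfl := List.append_cancel_left hR
      refine ⟨_, ⟨pre, p, post, hδ, Or.inl ⟨i', rfl⟩⟩, ?_⟩
      rw [Bool.not_not]
      exact (runGraph_chain_head (pre := [x]) (post := [y])).2
        ⟨rfl, L, R, rfl, rfl, hB, hN _ hB⟩

/-- If some initial configuration leads to a final configuration without rejecting, then the views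
do not even finitely determine the query. -/
theorem not_finitelyDetermines_of_accept [Finite T] {δ : Rules T K} {rej : T → K → T → Prop}
    {q₀ : K} {S : Set (List T × List T)} {L₀ R₀ : List T} (hS : (L₀, R₀) ∈ S) {C₁ : Config T K}
    (h₁ : δ.Reaches ⟨L₀, false, none, q₀, R₀⟩ C₁) (hhalt : ∀ C, ¬ δ.Step C₁ C)
    (hrej : ∀ C, δ.Reaches ⟨L₀, false, none, q₀, R₀⟩ C → ¬ C.InWindow rej) :
    ¬ FinitelyDetermines.{u} (ruleViews δ rej) (startLang q₀ S + badLang rej) := by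
  set C₀ : Config T K := ⟨L₀, false, none, q₀, R₀⟩
  have hfin : {C | δ.Reaches C₀ C}.Finite :=
    finite_reaches (fun _ _ _ h h' => h.unique h') h₁ hhalt
  have hrej : ∀ C ∈ {C | δ.Reaches C₀ C}, ¬ C.InWindow rej := hrej
  obtain ⟨N, hN⟩ := (hfin.image fun C => C.left.length + C.right.length).bddAbove
  have hN : ∀ C, δ.Reaches C₀ C → C.left.length ≤ N ∧ C.right.length ≤ N := by
    intro C hC
    have := hN ⟨C, hC, rfl⟩
    simp only at this
    omega
  intro hdet
  have key := hdet (Vertex T) (runGraph {C | δ.Reaches C₀ C} N false)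
    (runGraph {C | δ.Reaches C₀ C} N true) (finite_length_le N) (finite_length_le N) ?_
  · have hmem : (source, sink) ∈ (runGraph.{u} {C | δ.Reaches C₀ C} N false).answer
        (startLang q₀ S + badLang rej) := by
      refine ⟨_, Or.inl ⟨L₀, R₀, none, hS, rfl⟩, left [], .start, ?_⟩
      rw [← List.cons_append, ← List.append_assoc]
      refine LabeledGraph.chain_append.2 ⟨right [], runGraph_chain_head.2
        ⟨rfl, [], [], rfl, rfl, ?_, ?_⟩, LabeledGraph.chain_singleton.2 .close⟩
      · rw [List.append_nil, List.nil_append]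
        exact ReflTransGen.refl
      · rw [List.append_nil, List.nil_append]
        exact hN C₀ ReflTransGen.refl
    rw [key, LabeledGraph.answer_add, runGraph_answer_badLang hrej, Set.union_empty] at hmem
    obtain ⟨_, ⟨L, R, i, -, rfl⟩, h⟩ := hmem
    -- An initial word ends with `close false`, but the graph of colour `true` has no such edge.
    obtain ⟨_, _, h⟩ := h.exists_edge (a := close false) (by simp)
    cases h
  · rintro Q (⟨t, rfl⟩ | rfl | rfl | ⟨c, x, q, y, rfl⟩ | rfl)
    · ext ⟨s, t'⟩
      rw [LabeledGraph.mem_answer_singleton, LabeledGraph.mem_answer_singleton]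
      constructor <;> intro h <;> cases h <;> constructor <;> assumption
    · ext ⟨s, t'⟩
      rw [LabeledGraph.mem_answer_singleton, LabeledGraph.mem_answer_singleton]
      constructor <;> intro h <;> cases h <;> constructor
    · ext ⟨s, t'⟩
      simp only [LabeledGraph.answer_add, Set.mem_union, LabeledGraph.mem_answer_singleton]
      constructor
      · rintro (h | h) <;> cases h
        exact Or.inr .close
      · rintro (h | h) <;> cases h
        exact Or.inl .close
    · exact (runGraph_answer_stepLang_subset rfl hN c false x q y).antisymm
        (runGraph_answer_stepLang_subset rfl hN c true x q y)
    · rw [runGraph_answer_badLang hrej, runGraph_answer_badLang hrej]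


/-! ### Turing machines as rewriting systems -/

open Relation Letter Turing

section TuringMachine

variable {Γ Λ : Type}

/-- The end marker `none`, kept if `y` is the end marker. -/
def endMark : Option Γ → List (Option Γ)
  | none => [none]
  | some _ => []

/-- The left part of a configuration, for a tape with the symbols `L` to the left of the head. -/
def leftWord (L : List Γ) : List (Option Γ) := none :: (L.map some).reverse

/-- The right part of a configuration, for a tape with the symbols `R` from the head on. -/
def rightWord (R : List Γ) : List (Option Γ) := R.map some ++ [none]

theorem leftWord_cons (a : Γ) (L : List Γ) : leftWord (a :: L) = leftWord L ++ [some a] := by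
  simp [leftWord]

theorem rightWord_cons (a : Γ) (R : List Γ) : rightWord (a :: R) = some a :: rightWord R := rfl

variable [Inhabited Γ] [Inhabited Λ]

/-- A Turing machine as a rewriting system: the tape symbols are surrounded by end markers `none`,
and the state `none` is entered after halting, one cell to the right. -/
def tapeRules (M : TM0.Machine Γ Λ) : Rules (Option Γ) (Option Λ) := fun x q y =>
  q.map fun q => match M q (y.getD default) with
    | none => ([x, some (y.getD default)], none, endMark y)
    | some (p, .write a) => ([x], some p, some a :: endMark y)
    | some (p, .move .right) => ([x, some (y.getD default)], some p, endMark y)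
    | some (p, .move .left) =>
      (endMark x, some p, some (x.getD default) :: some (y.getD default) :: endMark y)

/-- An end marker is read as a blank and put back by `endMark`, so empty and nonempty sides are
treated uniformly through `headI` and `tail`. -/
theorem exists_leftWord_eq (L : List Γ) : ∃ L' x, leftWord L = L' ++ [x] ∧
    x.getD default = L.headI ∧ L' ++ endMark x = leftWord L.tail := by
  cases L with
  | nil => exact ⟨[], none, rfl, rfl, rfl⟩
  | cons a L => exact ⟨leftWord L, some a, leftWord_cons a L, rfl, by simp [endMark]⟩

theorem exists_rightWord_eq (R : List Γ) : ∃ y R', rightWord R = y :: R' ∧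
    y.getD default = R.headI ∧ endMark y ++ R' = rightWord R.tail := by
  cases R with
  | nil => exact ⟨none, [], rfl, rfl, rfl⟩
  | cons a R => exact ⟨some a, rightWord R, rfl, rfl, rfl⟩

/-- The configuration `C` represents the configuration `c` of a Turing machine. -/
def Represents (C : Config (Option Γ) (Option Λ)) (c : TM0.Cfg Γ Λ) : Prop :=
  ∃ L R, C.left = leftWord L ∧ C.right = rightWord R ∧ C.state = some c.q ∧
    c.Tape = Tape.mk' (ListBlank.mk L) (ListBlank.mk R)

theorem Represents.step {M : TM0.Machine Γ Λ} {C : Config (Option Γ) (Option Λ)}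
    {c c' : TM0.Cfg Γ Λ} (h : Represents C c) (hc : TM0.step M c = some c') :
    ∃ C', (tapeRules M).Step C C' ∧ Represents C' c' := by
  obtain ⟨_, par, i, _, _⟩ := C
  obtain ⟨q, _⟩ := c
  obtain ⟨L, R, hL, hR, hq, hT⟩ := h
  dsimp only at hL hR hq hT
  subst hL hR hq hT
  obtain ⟨L', x, hL, hx, hL'⟩ := exists_leftWord_eq L
  obtain ⟨y, R', hR, hy, hR'⟩ := exists_rightWord_eq R
  simp only [TM0.step, Option.map_eq_some_iff, Tape.mk'_head, ListBlank.head_mk] at hc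
  obtain ⟨⟨p, s⟩, hM, rfl⟩ := hc
  rw [← hy] at hM
  rw [hL, hR]
  rcases s with (_ | _) | a
  · refine ⟨_, .mk L' R' par i (by simp only [tapeRules, Option.map_some, hM]; rfl), L.tail,
      L.headI :: R.headI :: R.tail, hL', ?_, rfl, ?_⟩
    · simp [← hx, ← hy, ← hR', rightWord_cons]
    -- `ListBlank` ignores trailing blanks, so `R.headI :: R.tail` represents the same half-tape as
    -- `R` even when `R` is empty.
    · simp only [Tape.move_left_mk', ListBlank.tail_mk, ListBlank.head_mk]
      rw [← ListBlank.cons_mk, ← ListBlank.cons_mk, ← ListBlank.tail_mk R, ← ListBlank.head_mk R,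
        ListBlank.cons_head_tail]
  · refine ⟨_, .mk L' R' par i (by simp only [tapeRules, Option.map_some, hM]; rfl),
      R.headI :: L, R.tail, ?_, hR', rfl, ?_⟩
    · simp [leftWord_cons, ← hy, hL]
    · simp only [Tape.move_right_mk', ListBlank.tail_mk, ListBlank.head_mk, ListBlank.cons_mk]
  · refine ⟨_, .mk L' R' par i (by simp only [tapeRules, Option.map_some, hM]; rfl),
      L, a :: R.tail, ?_, ?_, rfl, ?_⟩
    · simp [hL]
    · simp [← hR', rightWord_cons]
    · dsimp only
      rw [Tape.write_mk', ListBlank.tail_mk, ListBlank.cons_mk]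

/-- The extra step to the right brings the answer cell into the window, where rejection can test it.
-/
theorem Represents.halt {M : TM0.Machine Γ Λ} {C : Config (Option Γ) (Option Λ)}
    {c : TM0.Cfg Γ Λ} (h : Represents C c) (hc : TM0.step M c = none) :
    ∃ C', (tapeRules M).Step C C' ∧ C'.state = none ∧ ∃ L x y R, C'.left = L ++ [x] ∧
      C'.right = y :: R ∧ y.getD default = c.Tape.right.head := by
  obtain ⟨_, par, i, _, _⟩ := C
  obtain ⟨q, _⟩ := c
  obtain ⟨L, R, hL, hR, hq, hT⟩ := h
  dsimp only at hL hR hq hT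
  subst hL hR hq hT
  obtain ⟨L', x, hL, hx, hL'⟩ := exists_leftWord_eq L
  obtain ⟨y, R', hR, hy, hR'⟩ := exists_rightWord_eq R
  obtain ⟨y', R'', hR₂, hy', -⟩ := exists_rightWord_eq R.tail
  simp only [TM0.step, Option.map_eq_none_iff, Tape.mk'_head, ListBlank.head_mk] at hc
  rw [← hy] at hc
  rw [hL, hR]
  refine ⟨_, .mk L' R' par i (by simp only [tapeRules, Option.map_some, hc]; rfl), rfl,
    L' ++ [x], some (y.getD default), y', R'', by simp, hR'.trans hR₂, ?_⟩
  simpa using hy'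

theorem Represents.reaches {M : TM0.Machine Γ Λ} {C : Config (Option Γ) (Option Λ)}
    {c c' : TM0.Cfg Γ Λ} (h : Represents C c) (hc : StateTransition.Reaches (TM0.step M) c c') :
    ∃ C', (tapeRules M).Reaches C C' ∧ Represents C' c' := by
  induction hc with
  | refl => exact ⟨C, .refl, h⟩
  | tail _ h' ih =>
    obtain ⟨C', hC', hr⟩ := ih
    obtain ⟨C'', hC'', hr'⟩ := hr.step h'
    exact ⟨C'', hC'.tail hC'', hr'⟩

theorem tapeRules_not_step {M : TM0.Machine Γ Λ} {C C' : Config (Option Γ) (Option Λ)}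
    (h : C.state = none) : ¬ (tapeRules M).Step C C' := by
  rintro ⟨L, R, c, i, hδ⟩
  simp only at h
  simp [h, tapeRules] at hδ

/-- The windows in which the run of a Turing machine is rejected: it has halted, and the symbol to
the right of the head is not accepted. -/
def haltReject (acc : Γ → Prop) : Option Γ → Option Λ → Option Γ → Prop :=
  fun _ q y => q = none ∧ ¬ acc (y.getD default)

theorem represents_init (i : Option (Option Γ × Option Λ × Option Γ)) (l : List Γ) :
    Represents ⟨leftWord [], false, i, some default, rightWord l⟩ (TM0.init l : TM0.Cfg Γ Λ) :=
  ⟨[], l, rfl, rfl, rfl, rfl⟩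

theorem exists_final {M : TM0.Machine Γ Λ} {l : List Γ} {c : TM0.Cfg Γ Λ}
    (hc : c ∈ StateTransition.eval (TM0.step M) (TM0.init l))
    (i : Option (Option Γ × Option Λ × Option Γ)) :
    ∃ C, (tapeRules M).Reaches ⟨leftWord [], false, i, some default, rightWord l⟩ C ∧
      C.state = none ∧ ∃ L x y R, C.left = L ++ [x] ∧
      C.right = y :: R ∧ y.getD default = c.Tape.right.head := by
  obtain ⟨hc, hhalt⟩ := StateTransition.mem_eval.1 hc
  obtain ⟨C, hC, hr⟩ := (represents_init i l).reaches hc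
  obtain ⟨C', hC', h⟩ := hr.halt hhalt
  exact ⟨C', hC.tail hC', h⟩

/-- If on all inputs in `I` the machine halts without accepting, then the views determine the
query. -/
theorem determines_of_haltReject {M : TM0.Machine Γ Λ} {acc : Γ → Prop} {I : Set (List Γ)}
    (hI : ∀ l ∈ I, ∃ c ∈ StateTransition.eval (TM0.step M) (TM0.init l), ¬ acc c.Tape.right.head) :
    Determines.{u} (ruleViews (tapeRules M) (haltReject acc))
      (startLang (some default) {p | p.1 = leftWord [] ∧ ∃ l ∈ I, p.2 = rightWord l} +
        badLang (haltReject acc)) := by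
  refine determines_of_reject ?_
  rintro _ _ i ⟨rfl, l, hl, rfl⟩
  obtain ⟨c, hc, hacc⟩ := hI l hl
  obtain ⟨C, hC, hstate, L, x, y, R, hL, hR, hy⟩ := exists_final hc i
  exact ⟨C, hC, L, x, y, R, hL, hR, hstate, hy ▸ hacc⟩

/-- If on some input in `I` the machine halts and accepts, then the views do not finitely
determine the query. -/
theorem not_finitelyDetermines_of_halt [Finite Γ] {M : TM0.Machine Γ Λ} {acc : Γ → Prop}
    {I : Set (List Γ)} {l : List Γ} (hl : l ∈ I) {c : TM0.Cfg Γ Λ}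
    (hc : c ∈ StateTransition.eval (TM0.step M) (TM0.init l)) (hacc : acc c.Tape.right.head) :
    ¬ FinitelyDetermines.{u} (ruleViews (tapeRules M) (haltReject acc))
      (startLang (some default) {p | p.1 = leftWord [] ∧ ∃ l ∈ I, p.2 = rightWord l} +
        badLang (haltReject acc)) := by
  obtain ⟨C, hC, hstate, L, x, y, R, hL, hR, hy⟩ := exists_final hc none
  refine not_finitelyDetermines_of_accept (L₀ := leftWord []) (R₀ := rightWord l)
    ⟨rfl, l, hl, rfl⟩ hC (fun _ => tapeRules_not_step hstate) ?_
  rintro C' hC' ⟨L', x', y', R', -, hR', hstate', hrej⟩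
  -- Both configurations are halted and lie on the same deterministic run.
  have : C' = C := by
    rcases ReflTransGen.total_of_right_unique (fun _ _ _ h h' => h.unique h') hC' hC with h | h
    · rcases h.cases_head with h | ⟨_, h, -⟩
      · exact h
      · exact absurd h (tapeRules_not_step hstate')
    · rcases h.cases_head with h | ⟨_, h, -⟩
      · exact h.symm
      · exact absurd h (tapeRules_not_step hstate)
  subst this
  rw [hR] at hR'
  cases hR'
  exact hrej (hy ▸ hacc)

end TuringMachine


/-! ### Recursively enumerable predicates and finite machines -/

open Turing

theorem primrec_two_pow : Primrec fun n : ℕ => 2 ^ n := by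
  have : Primrec₂ fun m n : ℕ => m ^ n := Primrec₂.unpaired'.1 Nat.Primrec.pow
  exact this.comp (Primrec.const 2) Primrec.id

theorem exists_computable_log : ∃ f : ℕ → ℕ, Computable f ∧ ∀ m, f (2 ^ m) = m := by
  refine ⟨fun n => Nat.findGreatest (fun m => 2 ^ m ≤ n) n, Primrec.to_comp ?_, fun m => ?_⟩
  · exact Primrec.nat_findGreatest Primrec.id
      (Primrec.nat_le.comp (primrec_two_pow.comp Primrec.snd) Primrec.fst)
  · rw [Nat.findGreatest_eq_iff]
    refine ⟨Nat.lt_two_pow_self.le, fun _ => le_rfl, fun n hn _ => ?_⟩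
    exact not_le.2 (Nat.pow_lt_pow_right one_lt_two hn)

/-- A recursively enumerable predicate is the projection of a decidable relation; the arguments
are given by powers of two. -/
theorem REPred.exists_computable {p : ℕ → Prop} (hp : REPred p) :
    ∃ F : ℕ → ℕ → Bool, Computable₂ F ∧ ∀ m, p m ↔ ∃ k, F (2 ^ k) (2 ^ m) = true := by
  obtain ⟨f, hf, hlog⟩ := exists_computable_log
  -- Precomposition with the logarithm `f` gives a code that answers for `m` on input `2 ^ m`.
  have hg : Partrec fun n : ℕ => (Part.assert (p (f n)) fun _ => Part.some ()).map fun _ => 0 :=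
    (hp.comp hf).map (Computable.const 0).to₂
  obtain ⟨c, hc⟩ := Nat.Partrec.Code.exists_code.1 (Partrec.nat_iff.1 hg)
  refine ⟨fun k n => (c.evaln k n).isSome, ?_, fun m => ?_⟩
  · refine Primrec.to_comp (Primrec.option_isSome.comp
      (Nat.Partrec.Code.primrec_evaln.comp (Primrec.pair (Primrec.pair Primrec.fst
        (Primrec.const c)) Primrec.snd)))
  · have h₁ : p m ↔ 0 ∈ c.eval (2 ^ m) := by
      rw [hc]
      simp [Part.mem_map_iff, Part.mem_assert_iff, hlog]
    rw [h₁, Nat.Partrec.Code.evaln_complete]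
    constructor
    -- The fuel may be raised from `k` to `2 ^ k`, since `evaln` is monotone in it.
    · rintro ⟨k, hk⟩
      exact ⟨k, Option.isSome_iff_exists.2
        ⟨0, Nat.Partrec.Code.evaln_mono Nat.lt_two_pow_self.le hk⟩⟩
    · rintro ⟨k, hk⟩
      obtain ⟨x, hx⟩ := Option.isSome_iff_exists.1 hk
      have hx' := Nat.Partrec.Code.evaln_sound hx
      rw [hc] at hx'
      obtain ⟨_, -, rfl⟩ := (Part.mem_map_iff _).1 hx'
      exact ⟨_, hx⟩

/-- A supported Turing machine can be restricted to finitely many states. -/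
theorem exists_finite_machine {Γ Λ : Type} [Inhabited Γ] [Inhabited Λ] (M : TM0.Machine Γ Λ)
    {S : Set Λ} (hfin : S.Finite) (hS : TM0.Supports M S) :
    ∃ (Λ' : Type) (_ : Inhabited Λ') (_ : Finite Λ') (M' : TM0.Machine Γ Λ'),
      ∀ l, ∀ c ∈ StateTransition.eval (TM0.step M) (TM0.init l),
        ∃ c' ∈ StateTransition.eval (TM0.step M') (TM0.init l),
          c'.Tape.right.head = c.Tape.right.head := by
  classical
  let ι : Inhabited S := ⟨⟨default, hS.1⟩⟩
  let f : PointedMap Γ Γ := ⟨id, rfl⟩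
  -- States outside `S` can be sent anywhere, as the run never leaves `S`.
  let g : PointedMap Λ S :=
    ⟨fun q => if h : q ∈ S then ⟨q, h⟩ else default, dif_pos hS.1⟩
  have hg : ∀ q ∈ S, (g q : Λ) = q := fun q hq => congrArg Subtype.val (dif_pos hq)
  refine ⟨S, ι, hfin, M.map f f g (↑), fun l c hc => ?_⟩
  have hinit : TM0.Cfg.map f g (TM0.init l) = TM0.init l := by
    rw [TM0.map_init]
    exact congrArg _ (List.map_id l)
  obtain ⟨c', ⟨-, rfl⟩, hc'⟩ := StateTransition.tr_eval
    (M.map_respects f f g (↑) hS (fun _ => rfl) hg) ⟨hS.1, hinit⟩ hc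
  exact ⟨_, hc', ListBlank.head_map f _⟩

open PartrecToTM2 in
theorem trNat_two_pow (n : ℕ) : trNat (2 ^ n) = List.replicate n Γ'.bit0 ++ [Γ'.bit1] := by
  have key : ∃ p : PosNum, (p : ℕ) = 2 ^ n ∧
      trPosNum p = List.replicate n Γ'.bit0 ++ [Γ'.bit1] := by
    induction n with
    | zero => exact ⟨1, rfl, rfl⟩
    | succ n ih =>
      obtain ⟨p, hp, h⟩ := ih
      refine ⟨p.bit0, ?_, ?_⟩
      · rw [PosNum.cast_bit0, hp]
        ring
      · rw [trPosNum, h]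
        rfl
  obtain ⟨p, hp, h⟩ := key
  rw [trNat, ← hp, ← h]
  have : (((Num.pos p : Num) : ℕ) : Num) = Num.pos p := Num.of_to_nat _
  exact congrArg trNum this

/-- On the tape a stack is laid out from its bottom, and only the bottom cell carries the flag
`true`. -/
theorem trInit_cons_reverse {K : Type} [DecidableEq K] {Γ : K → Type} (k : K) (a : Γ k)
    (l : List (Γ k)) :
    TM2to1.trInit k (a :: l).reverse = (true, Function.update (fun _ => none) k (some a)) ::
      l.map fun a => (false, Function.update (fun _ => none) k (some a)) := by
  rw [TM2to1.trInit, List.reverse_reverse]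
  rfl

instance : Finite PartrecToTM2.K' :=
  Finite.of_injective (β := Fin 4) (fun k => match k with
    | .main => 0
    | .rev => 1
    | .aux => 2
    | .stack => 3) (by rintro (_ | _ | _ | _) (_ | _ | _ | _) h <;> first | rfl | simp at h)

open PartrecToTM2 in
/-- A total computable function is decided by a Turing machine with finitely many states. The
answer is read off the cell to the right of the head in the final configuration. -/
theorem exists_machine_of_computable {F : ℕ → ℕ → Bool} (hF : Computable₂ F) :
    ∃ (Γ Λ : Type) (_ : Inhabited Γ) (_ : Inhabited Λ) (_ : Finite Γ) (_ : Finite Λ)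
      (M : TM0.Machine Γ Λ) (a b d z : Γ) (acc : Γ → Prop), ∀ m k,
        ∃ c ∈ StateTransition.eval (TM0.step M)
          (TM0.init (a :: b :: (List.replicate m z ++ d :: b :: List.replicate k z))),
          (acc c.Tape.right.head ↔ F (2 ^ k) (2 ^ m) = true) := by
  classical
  have hF' : Computable₂ fun k m => (F k m).toNat :=
    (Computable.cond hF (Computable.const 1) (Computable.const 0)).of_eq fun p => by
      dsimp only
      cases F p.1 p.2 <;> rfl
  obtain ⟨cd, hcd⟩ := ToPartrec.Code.exists_code (Nat.Partrec'.part_iff₂.2 hF'.partrec₂)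
  let ι : Inhabited PartrecToTM2.Λ' := ⟨trNormal cd Cont'.halt⟩
  have : Fintype K' := Fintype.ofFinite _
  let M₂ : PartrecToTM2.Λ' → TM2.Stmt (fun _ : K' => PartrecToTM2.Γ') PartrecToTM2.Λ'
    (Option PartrecToTM2.Γ') := PartrecToTM2.tr
  have hsupp := TM1to0.tr_supports (TM2to1.tr M₂)
    (TM2to1.tr_supports M₂ (PartrecToTM2.tr_supports cd Cont'.halt))
  obtain ⟨Λ, _, _, M, hM⟩ := exists_finite_machine _ (Finset.finite_toSet _) hsupp
  let sym : Bool → PartrecToTM2.Γ' → TM2to1.Γ' K' (fun _ => PartrecToTM2.Γ') := fun c s =>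
    (c, Function.update (fun _ => none) .main (some s))
  refine ⟨_, Λ, inferInstance, inferInstance,
    Finite.of_fintype (TM2to1.Γ' K' (fun _ => PartrecToTM2.Γ')), inferInstance, M,
    sym true .cons, sym false .bit1, sym false .cons, sym false .bit0,
    fun s => s.2 .main = some .bit1, fun m k => ?_⟩
  -- Binary digits are listed from the least significant one, so reversal puts each leading `bit1`
  -- before its zeros. The second argument comes first.
  have hv : trList [2 ^ k, 2 ^ m] = (Γ'.cons :: Γ'.bit1 :: (List.replicate m Γ'.bit0 ++
      Γ'.cons :: Γ'.bit1 :: List.replicate k Γ'.bit0)).reverse := by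
    simp [trNat_two_pow]
  have hinit : TM2to1.trInit (Γ := fun _ => PartrecToTM2.Γ') K'.main (trList [2 ^ k, 2 ^ m]) =
      sym true .cons :: sym false .bit1 :: (List.replicate m (sym false .bit0) ++
        sym false .cons :: sym false .bit1 :: List.replicate k (sym false .bit0)) := by
    rw [hv, trInit_cons_reverse]
    simp only [List.map_cons, List.map_append, List.map_replicate]
    rfl
  rw [← hinit]
  have h₂ : trList [(F (2 ^ k) (2 ^ m)).toNat] ∈ TM2.eval M₂ K'.main (trList [2 ^ k, 2 ^ m]) := by
    have hev := PartrecToTM2.tr_eval cd [2 ^ k, 2 ^ m]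
    have hc : cd.eval [2 ^ k, 2 ^ m] = Part.some [(F (2 ^ k) (2 ^ m)).toNat] :=
      (hcd ⟨[2 ^ k, 2 ^ m], rfl⟩).trans (Part.map_some _ _)
    have hst : TM2.init (Γ := fun _ => PartrecToTM2.Γ') K'.main (trList [2 ^ k, 2 ^ m]) =
        PartrecToTM2.init cd [2 ^ k, 2 ^ m] := by
      refine congrArg (TM2.Cfg.mk _ _) (funext fun i => ?_)
      cases i <;> rfl
    rw [TM2.eval, hst, Part.mem_map_iff]
    refine ⟨PartrecToTM2.halt [(F (2 ^ k) (2 ^ m)).toNat], ?_, rfl⟩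
    exact hev ▸ hc ▸ (Part.mem_map_iff _).2 ⟨_, Part.mem_some _, rfl⟩
  have hdom : (TM0.eval (TM1to0.tr (TM2to1.tr M₂))
      (TM2to1.trInit K'.main (trList [2 ^ k, 2 ^ m]))).Dom := by
    rw [TM1to0.tr_eval, TM2to1.tr_eval_dom]
    exact Part.dom_iff_mem.2 ⟨_, h₂⟩
  obtain ⟨L₁, h₁⟩ := Part.dom_iff_mem.1 hdom
  have h₁' := h₁
  rw [TM1to0.tr_eval] at h₁'
  obtain ⟨S, L', hL', hS, hmain⟩ := TM2to1.tr_eval M₂ K'.main _ h₁' h₂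
  obtain ⟨c, hc, rfl⟩ := (Part.mem_map_iff _).1 h₁
  obtain ⟨c', hc', hhead⟩ := hM _ c hc
  refine ⟨c', hc', ?_⟩
  -- The head ends on the bottom cell, holding the separator `cons`. The next cell holds the leading
  -- digit of the output: `bit1` for `1`, nothing for `0`.
  have hcell : (c.Tape.right.head).2 = L'.nth 1 := by
    rw [← TM2to1.addBottom_nth_snd, hL', ListBlank.nth_succ, ListBlank.nth_zero]
    simp [Tape.right₀]
  have hout := congrArg (fun l => l.nth 1) (hS K'.main)
  simp only [ListBlank.nth_map, hmain, ListBlank.nth_mk] at hout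
  have hcell' : (c'.Tape.right.head).2 K'.main = L'.nth 1 K'.main := by
    rw [hhead]
    exact congrFun hcell _
  change (c'.Tape.right.head).2 K'.main = _ ↔ _
  rw [hcell', show L'.nth 1 K'.main = _ from hout]
  cases F (2 ^ k) (2 ^ m)
  · simp [trNat_zero]
  · have := trNat_two_pow 0
    simp_all


/-! ### Regular expressions for the views -/

open Letter Turing

section Regex

variable {α : Type}

/-- The language is given by a regular expression. -/
def IsRegex (L : Language α) : Prop := ∃ P : RegularExpression α, P.matches' = L

theorem IsRegex.of_iff {L L' : Language α} (h : IsRegex L) (hL : ∀ w, w ∈ L' ↔ w ∈ L) :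
    IsRegex L' := by
  rwa [show L' = L from Language.ext fun {w} => hL w]

theorem IsRegex.zero : IsRegex (0 : Language α) := ⟨0, rfl⟩

theorem IsRegex.add {L L' : Language α} : IsRegex L → IsRegex L' → IsRegex (L + L') := by
  rintro ⟨P, rfl⟩ ⟨P', rfl⟩
  exact ⟨P + P', rfl⟩

theorem IsRegex.mul {L L' : Language α} : IsRegex L → IsRegex L' → IsRegex (L * L') := by
  rintro ⟨P, rfl⟩ ⟨P', rfl⟩
  exact ⟨P * P', rfl⟩

theorem IsRegex.kstar {L : Language α} : IsRegex L → IsRegex (KStar.kstar L) := by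
  rintro ⟨P, rfl⟩
  exact ⟨P.star, rfl⟩

theorem isRegex_word (w : List α) : IsRegex ({w} : Language α) := by
  induction w with
  | nil => exact ⟨1, rfl⟩
  | cons a w ih =>
    obtain ⟨P, hP⟩ := ih
    refine ⟨.char a * P, ?_⟩
    rw [RegularExpression.matches'_mul, hP, RegularExpression.matches'_char]
    exact Set.image2_singleton

theorem isRegex_iUnion {ι : Type} [Finite ι] {f : ι → Language α} (hf : ∀ i, IsRegex (f i)) :
    IsRegex {w | ∃ i, w ∈ f i} := by
  have key : ∀ s : Set ι, s.Finite → IsRegex {w | ∃ i ∈ s, w ∈ f i} := by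
    intro s hs
    induction s, hs using Set.Finite.induction_on with
    | empty =>
      refine IsRegex.zero.of_iff fun w => ⟨?_, fun h => h.elim⟩
      rintro ⟨i, hi, -⟩
      exact hi
    | @insert i s _ _ ih =>
      refine ((hf i).add ih).of_iff fun w => ⟨?_, ?_⟩
      · rintro ⟨j, rfl | hj, h⟩
        · exact Or.inl h
        · exact Or.inr ⟨j, hj, h⟩
      · rintro (h | ⟨j, hj, h⟩)
        · exact ⟨i, Or.inl rfl, h⟩
        · exact ⟨j, Or.inr hj, h⟩
  exact (key Set.univ Set.finite_univ).of_iff fun w =>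
    exists_congr fun i => (and_iff_right trivial).symm

theorem isRegex_of_finite {L : Language α} {s : Set (List α)} (hs : s.Finite)
    (hL : ∀ w, w ∈ L ↔ w ∈ s) : IsRegex L := by
  have : Finite s := hs
  have key := isRegex_iUnion (fun w : s => isRegex_word (w : List α))
  refine key.of_iff fun w => ?_
  rw [hL]
  constructor
  · exact fun h => ⟨⟨w, h⟩, rfl⟩
  · rintro ⟨⟨w', h⟩, rfl⟩
    exact h

theorem isRegex_top [Finite α] : IsRegex (⊤ : Language α) := by
  have key := (isRegex_iUnion (fun a : α => isRegex_word [a])).kstar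
  refine key.of_iff fun w => ?_
  refine ⟨fun _ => Language.mem_kstar.2 ⟨w.map fun a => [a], by simp [← List.flatMap_def], ?_⟩,
    fun _ => trivial⟩
  · intro y hy
    obtain ⟨a, -, rfl⟩ := List.mem_map.1 hy
    exact ⟨a, rfl⟩

theorem mem_word_mul {u w : List α} {L : Language α} :
    w ∈ ({u} : Language α) * L ↔ ∃ v ∈ L, w = u ++ v := by
  rw [Language.mem_mul]
  constructor
  · rintro ⟨_, rfl, v, hv, rfl⟩
    exact ⟨v, hv, rfl⟩
  · rintro ⟨v, hv, rfl⟩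
    exact ⟨_, rfl, v, hv, rfl⟩

theorem mem_top_mul {w : List α} {L : Language α} :
    w ∈ ⊤ * L ↔ ∃ u, ∃ v ∈ L, w = u ++ v := by
  rw [Language.mem_mul]
  constructor
  · rintro ⟨u, -, v, hv, rfl⟩
    exact ⟨u, v, hv, rfl⟩
  · rintro ⟨u, v, hv, rfl⟩
    exact ⟨u, trivial, v, hv, rfl⟩

end Regex

section Views

instance [Finite T] [Finite K] : Finite (Letter T K) := by
  let f : Letter T K → Unit ⊕ Bool ⊕ T ⊕ (Bool × Option (T × K × T) × K)
    | start => .inl ()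
    | close c => .inr (.inl c)
    | tape t => .inr (.inr (.inl t))
    | head c i q => .inr (.inr (.inr (c, i, q)))
  refine Finite.of_injective f ?_
  rintro (_ | _ | _ | _) (_ | _ | _ | _) h <;> simp_all [f]

variable [Finite T] [Finite K]

theorem isRegex_stepLang (δ : Rules T K) (c : Bool) (x : T) (q : K) (y : T) :
    IsRegex (stepLang δ c x q y) := by
  cases h : δ x q y with
  | none =>
    refine isRegex_of_finite Set.finite_empty fun w => ⟨?_, fun h' => h'.elim⟩
    rintro ⟨_, _, _, h', -⟩
    cases h.symm.trans h'
  | some r =>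
    obtain ⟨pre, p, post⟩ := r
    refine isRegex_of_finite ((Set.finite_range fun i : Option (T × K × T) =>
      [tape x, head c i q, tape y]).insert
        (pre.map tape ++ head (!c) (some (x, q, y)) p :: post.map tape)) fun w => ?_
    constructor
    · rintro ⟨pre', p', post', h', ⟨i, rfl⟩ | rfl⟩
      · exact Or.inr ⟨i, rfl⟩
      · rw [h] at h'
        cases h'
        exact Or.inl rfl
    · rintro (rfl | ⟨i, rfl⟩)
      · exact ⟨pre, p, post, h, Or.inr rfl⟩
      · exact ⟨pre, p, post, h, Or.inl ⟨i, rfl⟩⟩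

theorem isRegex_badLang (rej : T → K → T → Prop) : IsRegex (badLang rej) := by
  have htop := isRegex_top (α := Letter T K)
  refine IsRegex.add ?_ ?_
  · have key := isRegex_iUnion fun j : Bool × Option (T × K × T) × K =>
      (isRegex_word [start]).mul (htop.mul ((isRegex_word [head j.1 j.2.1 j.2.2]).mul
        (htop.mul (isRegex_word [close (!j.1)]))))
    refine key.of_iff fun w => ?_
    constructor
    · rintro ⟨u, v, c, i, q, rfl⟩
      exact ⟨(c, i, q), mem_word_mul.2 ⟨_, mem_top_mul.2 ⟨u, _, mem_word_mul.2
        ⟨_, mem_top_mul.2 ⟨v, _, rfl, rfl⟩, rfl⟩, rfl⟩, rfl⟩⟩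
    · rintro ⟨⟨c, i, q⟩, h⟩
      obtain ⟨_, h₁, rfl⟩ := mem_word_mul.1 h
      obtain ⟨u, _, h₂, rfl⟩ := mem_top_mul.1 h₁
      obtain ⟨_, h₃, rfl⟩ := mem_word_mul.1 h₂
      obtain ⟨v, _, rfl, rfl⟩ := mem_top_mul.1 h₃
      exact ⟨u, v, c, i, q, rfl⟩
  · have key := isRegex_iUnion fun j : {j : T × K × T // rej j.1 j.2.1 j.2.2} × Bool ×
        Option (T × K × T) × Bool =>
      (isRegex_word [start]).mul (htop.mul ((isRegex_word [tape j.1.1.1,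
        head j.2.1 j.2.2.1 j.1.1.2.1, tape j.1.1.2.2]).mul
          (htop.mul (isRegex_word [close j.2.2.2]))))
    refine key.of_iff fun w => ?_
    constructor
    · rintro ⟨u, v, c, i, c', x, q, y, hrej, rfl⟩
      exact ⟨(⟨(x, q, y), hrej⟩, c, i, c'), mem_word_mul.2 ⟨_, mem_top_mul.2 ⟨u, _,
        mem_word_mul.2 ⟨_, mem_top_mul.2 ⟨v, _, rfl, rfl⟩, rfl⟩, rfl⟩, rfl⟩⟩
    · rintro ⟨⟨⟨⟨x, q, y⟩, hrej⟩, c, i, c'⟩, h⟩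
      obtain ⟨_, h₁, rfl⟩ := mem_word_mul.1 h
      obtain ⟨u, _, h₂, rfl⟩ := mem_top_mul.1 h₁
      obtain ⟨_, h₃, rfl⟩ := mem_word_mul.1 h₂
      obtain ⟨v, _, rfl, rfl⟩ := mem_top_mul.1 h₃
      exact ⟨u, v, c, i, c', x, q, y, hrej, rfl⟩

/-- The views are given by a finite list of regular expressions. -/
theorem exists_ruleViews_regex (δ : Rules T K) (rej : T → K → T → Prop) :
    ∃ l : List (RegularExpression (Letter T K)), {L | ∃ P ∈ l, P.matches' = L} = ruleViews δ rej := by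
  have hreg : ∀ L ∈ ruleViews δ rej, IsRegex L := by
    rintro L (⟨t, rfl⟩ | rfl | rfl | ⟨c, x, q, y, rfl⟩ | rfl)
    · exact isRegex_word _
    · exact isRegex_word _
    · exact (isRegex_word _).add (isRegex_word _)
    · exact isRegex_stepLang ..
    · exact isRegex_badLang rej
  have hfin : (ruleViews δ rej).Finite := by
    refine ((Set.finite_range fun t : T => ({[tape t]} : Language (Letter T K))).union
      ((((Set.finite_range fun j : Bool × T × K × T =>
        stepLang δ j.1 j.2.1 j.2.2.1 j.2.2.2).insert (badLang rej)).insert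
          ({[close false]} + {[close true]})).insert {[start]})).subset ?_
    rintro L (⟨t, rfl⟩ | rfl | rfl | ⟨c, x, q, y, rfl⟩ | rfl)
    · exact Or.inl ⟨t, rfl⟩
    · exact Or.inr (Or.inl rfl)
    · exact Or.inr (Or.inr (Or.inl rfl))
    · exact Or.inr (Or.inr (Or.inr (Or.inr ⟨(c, x, q, y), rfl⟩)))
    · exact Or.inr (Or.inr (Or.inr (Or.inl rfl)))
  choose! r hr using hreg
  refine ⟨hfin.toFinset.toList.map r, ?_⟩
  ext L
  constructor
  · rintro ⟨P, hP, rfl⟩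
    obtain ⟨L, hL, rfl⟩ := List.mem_map.1 hP
    have hL : L ∈ ruleViews δ rej := by simpa using hL
    rwa [hr L hL]
  · exact fun hL => ⟨r L, List.mem_map.2 ⟨L, by simpa using hL, rfl⟩, hr L hL⟩

end Views

/-! ### Change of alphabet -/

section Relabel

variable {α β : Type} {U : Type u}

/-- The graph with the labels pulled back along `f`. -/
def LabeledGraph.comap (f : α → β) (D : LabeledGraph β U) : LabeledGraph α U where
  verts := D.verts
  edge a := D.edge (f a)
  source_mem := D.source_mem
  target_mem := D.target_mem

theorem LabeledGraph.chain_comap (f : α → β) (D : LabeledGraph β U) (w : List α) (x y : U) :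
    (D.comap f).Chain w x y ↔ D.Chain (w.map f) x y := by
  induction w generalizing x with
  | nil => rfl
  | cons a w ih => exact exists_congr fun z => and_congr_right fun _ => ih z

theorem LabeledGraph.answer_comap (f : α → β) (D : LabeledGraph β U) (Q : Language α) :
    (D.comap f).answer Q = D.answer (Language.map f Q) := by
  ext ⟨x, y⟩
  constructor
  · rintro ⟨w, hw, h⟩
    exact ⟨w.map f, ⟨w, hw, rfl⟩, (chain_comap ..).1 h⟩
  · rintro ⟨_, ⟨w, hw, rfl⟩, h⟩
    exact ⟨w, hw, (chain_comap ..).2 h⟩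

/-- Pulling labels back along `f` turns the mapped queries into the original ones, so `f` need not
be injective. -/
theorem Determines.map {𝒬 : Set (Language α)} {Q₀ : Language α} (h : Determines.{u} 𝒬 Q₀)
    (f : α → β) : Determines.{u} (Language.map f '' 𝒬) (Language.map f Q₀) := by
  intro U D₁ D₂ hD
  rw [← LabeledGraph.answer_comap, ← LabeledGraph.answer_comap]
  refine h U _ _ fun Q hQ => ?_
  rw [LabeledGraph.answer_comap, LabeledGraph.answer_comap]
  exact hD _ ⟨Q, hQ, rfl⟩

theorem FinitelyDetermines.of_map {𝒬 : Set (Language α)} {Q₀ : Language α} (e : α ≃ β)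
    (h : FinitelyDetermines.{u} (Language.map e '' 𝒬) (Language.map e Q₀)) :
    FinitelyDetermines.{u} 𝒬 Q₀ := by
  intro U D₁ D₂ h₁ h₂ hD
  have key : ∀ (D : LabeledGraph α U) (Q : Language α),
      (D.comap e.symm).answer (Language.map e Q) = D.answer Q := by
    intro D Q
    rw [LabeledGraph.answer_comap, Language.map_map, e.symm_comp_self, Language.map_id]
  have := h U (D₁.comap e.symm) (D₂.comap e.symm) h₁ h₂ ?_
  · rwa [key, key] at this
  · rintro _ ⟨Q, hQ, rfl⟩
    rw [key, key]
    exact hD Q hQ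

theorem Determines.finitelyDetermines {𝒬 : Set (Language α)} {Q₀ : Language α}
    (h : Determines.{u} 𝒬 Q₀) : FinitelyDetermines.{u} 𝒬 Q₀ :=
  fun U D₁ D₂ _ _ hD => h U D₁ D₂ hD

end Relabel


/-! ### The reduction -/

open Letter Turing

/-- The regular expression `xⁿ P`. -/
def powRegex {α : Type} (x : α) (P : RegularExpression α) : ℕ → RegularExpression α
  | 0 => P
  | n + 1 => .comp (.char x) (powRegex x P n)

theorem mem_powRegex {α : Type} {x : α} {P : RegularExpression α} {n : ℕ} {w : List α} :
    w ∈ (powRegex x P n).matches' ↔ ∃ v ∈ P.matches', w = List.replicate n x ++ v := by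
  induction n generalizing w with
  | zero => simp [powRegex]
  | succ n ih =>
    have : (powRegex x P (n + 1)).matches' = {[x]} * (powRegex x P n).matches' := rfl
    rw [this, mem_word_mul]
    constructor
    · rintro ⟨v, hv, rfl⟩
      obtain ⟨v', hv', rfl⟩ := ih.1 hv
      exact ⟨v', hv', rfl⟩
    · rintro ⟨v, hv, rfl⟩
      exact ⟨_, ih.2 ⟨v, hv, rfl⟩, rfl⟩

theorem map_powRegex {α β : Type} (f : α → β) (x : α) (P : RegularExpression α) (n : ℕ) :
    (powRegex x P n).map f = powRegex (f x) (P.map f) n := by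
  induction n with
  | zero => rfl
  | succ n ih => rw [powRegex, RegularExpression.map, ih]; rfl

theorem mem_kstar_letter {α : Type} {x : α} {w : List α} :
    w ∈ KStar.kstar ({[x]} : Language α) ↔ ∃ k, w = List.replicate k x := by
  rw [Language.mem_kstar]
  constructor
  · rintro ⟨l, rfl, hl⟩
    refine ⟨l.length, ?_⟩
    rw [List.eq_replicate_of_mem (a := [x]) (l := l) hl]
    simp
  · rintro ⟨k, rfl⟩
    refine ⟨List.replicate k [x], by simp, fun y hy => ?_⟩
    exact List.eq_of_mem_replicate hy

/-- The initial configurations on the inputs `a b zᵐ d b zᵏ` for a fixed `m` are given by a regular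
expression that depends on `m` only through a power. -/
theorem exists_startLang_regex {Γ Λ : Type} [Finite Γ] [Finite Λ] (q₀ : Option Λ)
    (a b d z : Γ) :
    ∃ P P' : RegularExpression (Letter (Option Γ) (Option Λ)), ∀ m,
      (P * powRegex (tape (some z)) P' m).matches' = startLang q₀
        {p | p.1 = leftWord [] ∧ ∃ l ∈ {l | ∃ k, l = a :: b :: (List.replicate m z ++
          d :: b :: List.replicate k z)}, p.2 = rightWord l} := by
  obtain ⟨P, hP⟩ : IsRegex {w | ∃ i, w = [start, tape none, head false i q₀, tape (some a),
      tape (some b)]} :=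
    isRegex_iUnion fun i : Option (Option Γ × Option Λ × Option Γ) =>
      isRegex_word [start, tape none, head false i q₀, tape (some a), tape (some b)]
  obtain ⟨P', hP'⟩ := (isRegex_word [tape (some d), tape (some b)]).mul
    ((isRegex_word [tape (some z)]).kstar.mul
      (isRegex_word [tape none, (close false : Letter (Option Γ) (Option Λ))]))
  refine ⟨P, P', fun m => ?_⟩
  rw [RegularExpression.matches'_mul]
  ext w
  rw [Language.mem_mul]
  constructor
  · rintro ⟨u, hu, w', hw', rfl⟩
    rw [hP] at hu
    obtain ⟨i, rfl⟩ := hu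
    obtain ⟨v, hv, rfl⟩ := mem_powRegex.1 hw'
    rw [hP'] at hv
    obtain ⟨v', hv', rfl⟩ := mem_word_mul.1 hv
    obtain ⟨u, hu, _, rfl, rfl⟩ := Language.mem_mul.1 hv'
    obtain ⟨k, rfl⟩ := mem_kstar_letter.1 hu
    refine ⟨_, _, i, ⟨rfl, _, ⟨k, rfl⟩, rfl⟩, ?_⟩
    simp
  · rintro ⟨_, _, i, ⟨rfl, _, ⟨k, rfl⟩, rfl⟩, rfl⟩
    refine ⟨[start, tape none, head false i q₀, tape (some a), tape (some b)], ?_, _,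
      mem_powRegex.2 ⟨[tape (some d), tape (some b)] ++ (List.replicate k (tape (some z)) ++
        [tape none, close false]), ?_, rfl⟩, ?_⟩
    · rw [hP]
      exact ⟨i, rfl⟩
    · rw [hP']
      exact mem_word_mul.2 ⟨_, Language.mem_mul.2 ⟨_, mem_kstar_letter.2 ⟨k, rfl⟩, _, rfl, rfl⟩,
        rfl⟩
    · simp [leftWord, rightWord]

/-- A recursively enumerable predicate is reduced to the complement of the query determinacy
problem by instances that depend on the argument only through a power in a regular expression. -/
theorem REPred.exists_instance {p : ℕ → Prop} (hp : REPred p) :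
    ∃ (n : ℕ) (l : List (RegularExpression (Fin n))) (P P' B : RegularExpression (Fin n))
      (z : Fin n), ∀ m, (¬ p m → QDP.{u} ⟨n, l, .plus (.comp P (powRegex z P' m)) B⟩) ∧
        (p m → ¬ FiniteQDP.{u} ⟨n, l, .plus (.comp P (powRegex z P' m)) B⟩) := by
  obtain ⟨F, hF, hpF⟩ := REPred.exists_computable hp
  obtain ⟨Γ, Λ, _, _, _, _, M, a, b, d, z, acc, hM⟩ := exists_machine_of_computable hF
  obtain ⟨n, ⟨e⟩⟩ := Finite.exists_equiv_fin (Letter (Option Γ) (Option Λ))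
  obtain ⟨l, hl⟩ := exists_ruleViews_regex (tapeRules M) (haltReject acc)
  obtain ⟨P, P', hP⟩ := exists_startLang_regex (some (default : Λ)) a b d z
  obtain ⟨B, hB⟩ := isRegex_badLang (haltReject (Λ := Λ) acc)
  refine ⟨n, l.map (.map e), P.map e, P'.map e, B.map e, e (tape (some z)), fun m => ?_⟩
  have hviews : QDPInstance.views ⟨n, l.map (.map e), .plus (.comp (P.map e)
      (powRegex (e (tape (some z))) (P'.map e) m)) (B.map e)⟩ =
      Language.map e '' ruleViews (tapeRules M) (haltReject acc) := by
    rw [← hl]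
    ext L
    constructor
    · rintro ⟨_, hR', rfl⟩
      obtain ⟨R, hR, rfl⟩ := List.mem_map.1 hR'
      exact ⟨_, ⟨R, hR, rfl⟩, (RegularExpression.matches'_map e R).symm⟩
    · rintro ⟨_, ⟨R, hR, rfl⟩, rfl⟩
      exact ⟨_, List.mem_map.2 ⟨R, hR, rfl⟩, RegularExpression.matches'_map e R⟩
  have hquery : QDPInstance.query ⟨n, l.map (.map e), .plus (.comp (P.map e)
      (powRegex (e (tape (some z))) (P'.map e) m)) (B.map e)⟩ =
      Language.map e (P * powRegex (tape (some z)) P' m + B).matches' := by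
    rw [QDPInstance.query, ← map_powRegex]
    exact RegularExpression.matches'_map e (P * powRegex (tape (some z)) P' m + B)
  constructor
  · intro hm
    rw [QDP, hviews, hquery, RegularExpression.matches'_add, hP, hB]
    refine (determines_of_haltReject ?_).map e
    rintro _ ⟨k, rfl⟩
    obtain ⟨c, hc, hacc⟩ := hM m k
    exact ⟨c, hc, fun h => hm ((hpF m).2 ⟨k, hacc.1 h⟩)⟩
  · intro hm h
    rw [FiniteQDP, hviews, hquery, RegularExpression.matches'_add, hP, hB] at h
    obtain ⟨k, hk⟩ := (hpF m).1 hm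
    obtain ⟨c, hc, hacc⟩ := hM m k
    exact absurd (h.of_map e) (not_finitelyDetermines_of_halt ⟨k, rfl⟩ hc (hacc.2 hk))

/-- Only the exponent varies with `c`, and the code of the power arises from iterating one primitive
recursive operation on codes. -/
theorem computable_instance {γ : Type} [Primcodable γ] {n : ℕ}
    (l : List (RegularExpression (Fin n))) (P P' B : RegularExpression (Fin n)) (z : Fin n) :
    Computable fun c : γ => (⟨n, l, .plus (.comp P (powRegex z P' (Encodable.encode c))) B⟩ :
      QDPInstance) := by
  rw [← Computable.encode_iff]
  have hcomp : Primrec₂ fun (x y : ℕ) => 3 * Nat.pair x y + 1 + (n + 2) :=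
    Primrec.nat_add.comp (Primrec.nat_add.comp (Primrec.nat_mul.comp (Primrec.const 3)
      Primrec₂.natPair) (Primrec.const 1)) (Primrec.const _)
  have hpow : Primrec fun m => encodeRegex n (powRegex z P' m) := by
    refine (Primrec.nat_rec₁ (encodeRegex n P')
      (f := fun _ y => 3 * Nat.pair (encodeRegex n (.char z)) y + 1 + (n + 2))
      (hcomp.comp (Primrec.const _) Primrec.snd).to₂).of_eq fun m => ?_
    induction m with
    | zero => rfl
    | succ m ih => simp only [ih]; rfl
  have hmain : Primrec fun m => Nat.pair n (Nat.pair (Encodable.encode l)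
      (3 * Nat.pair (3 * Nat.pair (encodeRegex n P) (encodeRegex n (powRegex z P' m)) + 1 + (n + 2))
        (encodeRegex n B) + (n + 2))) :=
    Primrec₂.natPair.comp (Primrec.const _) (Primrec₂.natPair.comp (Primrec.const _)
      (Primrec.nat_add.comp (Primrec.nat_mul.comp (Primrec.const 3) (Primrec₂.natPair.comp
        (hcomp.comp (Primrec.const _) hpow) (Primrec.const _))) (Primrec.const _)))
  exact hmain.to_comp.comp Computable.encode

/-- Numbers that decode to nothing fall outside `p'`, because the decoding step then diverges. -/
theorem REPred.exists_nat {γ : Type} [Primcodable γ] {p : γ → Prop} (hp : REPred p) :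
    ∃ p' : ℕ → Prop, REPred p' ∧ ∀ c, p' (Encodable.encode c) ↔ p c := by
  refine ⟨_, ((Computable.decode (α := γ)).ofOption.bind
    (hp.comp Computable.snd).to₂).dom_re, fun c => ?_⟩
  simp [Encodable.encodek, Part.assert]

theorem coREHard : CoREHard QDP.{u} ∧ CoREHard FiniteQDP.{u} := by
  have key : ∀ (γ : Type) [Primcodable γ] (p : γ → Prop), REPred (fun c => ¬ p c) →
      ∃ f : γ → QDPInstance, Computable f ∧
        ∀ c, (p c → QDP.{u} (f c)) ∧ (¬ p c → ¬ FiniteQDP.{u} (f c)) := by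
    intro γ _ p hp
    obtain ⟨p', hp', h⟩ := REPred.exists_nat hp
    obtain ⟨n, l, P, P', B, z, hi⟩ := REPred.exists_instance.{u} hp'
    refine ⟨_, computable_instance l P P' B z, fun c => ?_⟩
    have := hi (Encodable.encode c)
    rwa [h, not_not] at this
  constructor
  · intro γ _ p hp
    obtain ⟨f, hf, h⟩ := key γ p hp
    exact ⟨f, hf, fun c => ⟨(h c).1, fun hq => by_contra fun hc =>
      (h c).2 hc hq.finitelyDetermines⟩⟩
  · intro γ _ p hp
    obtain ⟨f, hf, h⟩ := key γ p hp
    exact ⟨f, hf, fun c => ⟨fun hc => ((h c).1 hc).finitelyDetermines, fun hq =>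
      by_contra fun hc => (h c).2 hc hq⟩⟩

/-- The complement of the halting problem reduces to `q`; if `q` were decidable, that complement
would be recursively enumerable. -/
theorem CoREHard.not_computablePred {β : Type} [Primcodable β] {q : β → Prop} (h : CoREHard q) :
    ¬ ComputablePred q := by
  intro hq
  have hre : REPred fun c : Nat.Partrec.Code => ¬¬ (c.eval 0).Dom :=
    (ComputablePred.halting_problem_re 0).of_eq fun _ => not_not.symm
  exact ComputablePred.halting_problem_not_re 0
    (ComputablePred.computable_of_manyOneReducible (h _ _ hre) hq).to_re

end RPQ

theorem theorem1 :
    (¬ ComputablePred RPQ.QDP.{u} ∧ ¬ ComputablePred RPQ.FiniteQDP.{u}) ∧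
      (RPQ.CoREHard RPQ.QDP.{u} ∧ RPQ.CoREHard RPQ.FiniteQDP.{u}) :=
  ⟨⟨RPQ.coREHard.1.not_computablePred, RPQ.coREHard.2.not_computablePred⟩, RPQ.coREHard⟩
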